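/- Theorem. For $n\in\mathbb N$ let $Q_n$ be the $n$-dimensional hypercube graph, with vertex set $\{0,1\}^n$, in which two vectors are adjacent if and only if they differ in exactly one coordinate, and let $e(Q_n)$ be its number of edges. For an integer $d\ge 2$ let $f(n,d)$ be the minimal number of edges of a subgraph of $Q_n$ whose edge set intersects the edge set of every subgraph of $Q_n$ that is isomorphic to $Q_d$, and let $$\rho_d=\lim_{n\to\infty}\frac{f(n,d)}{e(Q_n)}.$$ There is a constant $c$ with $0<c<1$ such that, for every integer $d\ge 2$, this limit exists and $$\rho_d\le c^d .$$ -/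

import Mathlib

open Filter Topology

/-- The `n`-dimensional hypercube graph: two zero-one vectors are joined by an edge if they
differ in exactly one coordinate. -/
def hypercubeGraph (n : ℕ) : SimpleGraph (Fin n → Bool) where
  Adj x y := hammingDist x y = 1
  symm := ⟨fun x y h => by rw [hammingDist_comm]; exact h⟩
  loopless := ⟨fun x h => by simp at h⟩

/-- The subgraph `G` of the `n`-cube is a transversal for `d`-cubes: its edge set intersects the
edge set of every subgraph of the `n`-cube that is isomorphic to the `d`-cube. -/
def MeetsEveryCube {n : ℕ} (d : ℕ) (G : (hypercubeGraph n).Subgraph) : Prop :=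
  ∀ H : (hypercubeGraph n).Subgraph, Nonempty (H.coe ≃g hypercubeGraph d) →
    (G.edgeSet ∩ H.edgeSet).Nonempty

/-- The minimal number of edges of a subgraph of the `n`-cube whose edge set intersects the edge
set of every subgraph isomorphic to the `d`-cube (for `d ≥ 1` the whole `n`-cube is such a
subgraph, so that the minimum is over a nonempty set and is attained). -/
noncomputable def minEdgeTransversal (n d : ℕ) : ℕ :=
  sInf {m : ℕ | ∃ G : (hypercubeGraph n).Subgraph, MeetsEveryCube d G ∧ G.edgeSet.ncard = m}

/-- The proportion of the edges of the `n`-cube in a smallest edge transversal for `d`-cubes. -/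
noncomputable def edgeTransversalRatio (d n : ℕ) : ℝ :=
  (minEdgeTransversal n d : ℝ) / ((hypercubeGraph n).edgeSet.ncard : ℝ)

/-- The complementary edge-Turán density of the `d`-cube, the limit as `n → ∞` of the proportion
of edges in a smallest edge transversal. -/
noncomputable def complEdgeTuranDensity (d : ℕ) : ℝ :=
  limUnder atTop (edgeTransversalRatio d)

/-! The limit exists by averaging. A transversal of the (n+1)-cube restricts to a transversal of
each of its 2(n+1) facets, and each edge lies in n facets, so the ratio is nondecreasing in n. It
therefore suffices to bound it for every n.

A copy of Q_d in the cube is a subcube, given by a stem S and a d-set T of free coordinates.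
Selecting all edges whose lower end lies in a family P gives a transversal as soon as P contains
some S ∪ U with U a proper subset of T (`meetsEveryCube_lowerEndGraph`).

To get a sparse P, in each layer r attach to the n coordinates vectors of 𝔽₂^(r-s), and let P
consist of the r-sets whose vectors lie in a hyperplane. For random vectors a given r-set does so
with probability at most 2^(r-s)·2^(-r) = 2^(-s) (`exists_vectors_few_inHyperplane`). Conversely, a
stem of size r-s-2 is annihilated by independent functionals a and b. Over 𝔽₂ one of a, b, a+b
vanishes at any given vector, so one of the three kills a third of T, which leaves room for s+2
elements when d > 3(s+1) (`exists_subset_inHyperplane`). Thus s grows linearly in d, and the bound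
is exponential. -/

/-! ### Copies of the d-cube are subcubes. -/

/-- The zero-one vector with one coordinate flipped. -/
def flipAt {n : ℕ} (x : Fin n → Bool) (i : Fin n) : Fin n → Bool :=
  Function.update x i (!x i)

@[simp] theorem flipAt_self {n : ℕ} (x : Fin n → Bool) (i : Fin n) : flipAt x i i = !x i := by
  simp [flipAt]

theorem flipAt_of_ne {n : ℕ} (x : Fin n → Bool) {i j : Fin n} (h : j ≠ i) :
    flipAt x i j = x j := by
  simp [flipAt, h]

theorem flipAt_flipAt {n : ℕ} (x : Fin n → Bool) (i : Fin n) : flipAt (flipAt x i) i = x := by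
  funext j
  by_cases h : j = i
  · subst h; simp
  · simp [flipAt_of_ne, h]

theorem hypercubeGraph_adj_iff {n : ℕ} {x y : Fin n → Bool} :
    (hypercubeGraph n).Adj x y ↔ ∃ i, y = flipAt x i := by
  change hammingDist x y = 1 ↔ _
  rw [hammingDist, Finset.card_eq_one]
  constructor
  · rintro ⟨i, hi⟩
    refine ⟨i, ?_⟩
    have h : ∀ j, x j ≠ y j ↔ j = i := fun j => by
      simpa using congrArg (fun s => j ∈ s) hi
    funext j
    by_cases hj : j = i
    · subst hj
      have := (h j).2 rfl
      rw [flipAt_self]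
      revert this; cases x j <;> cases y j <;> simp
    · rw [flipAt_of_ne _ hj]
      by_contra hne
      exact hj ((h j).1 (Ne.symm hne))
  · rintro ⟨i, rfl⟩
    refine ⟨i, ?_⟩
    ext j
    by_cases hj : j = i
    · subst hj; simp
    · simp [flipAt_of_ne, hj]

theorem flipAt_injective {n : ℕ} (x : Fin n → Bool) : Function.Injective (flipAt x) := by
  intro i j h
  by_contra hne
  have := congrFun h i
  rw [flipAt_self, flipAt_of_ne _ hne] at this
  simp at this

theorem card_filter_flipAt {n : ℕ} {x : Fin n → Bool} {j : Fin n} (hj : x j = true) :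
    (Finset.univ.filter fun l => flipAt x j l = true).card
      = (Finset.univ.filter fun l => x l = true).card - 1 := by
  rw [← Finset.card_erase_of_mem (show j ∈ Finset.univ.filter fun l => x l = true by simpa using hj)]
  congr 1
  ext l
  by_cases hl : l = j
  · subst hl; simp [hj]
  · simp [flipAt_of_ne _ hl, hl]

/-- In a 4-cycle of the cube, opposite edges have the same direction. -/
theorem flipAt_square {n : ℕ} {z : Fin n → Bool} {a b p q : Fin n} (hab : a ≠ b)
    (h : flipAt (flipAt z a) p = flipAt (flipAt z b) q) (hz : flipAt (flipAt z a) p ≠ z) :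
    p = b := by
  have hpa : p ≠ a := by
    rintro rfl
    exact hz (flipAt_flipAt z p)
  by_contra hpb
  have hp := congrFun h p
  rw [flipAt_self, flipAt_of_ne _ hpa] at hp
  by_cases hpq : p = q
  · subst hpq
    have ha := congrFun h a
    rw [flipAt_of_ne _ hpa.symm, flipAt_self, flipAt_of_ne _ hpa.symm, flipAt_of_ne _ hab] at ha
    simp at ha
  · rw [flipAt_of_ne _ hpq, flipAt_of_ne _ hpb] at hp
    simp at hp

/-- An injective homomorphism of cubes is the embedding of a subcube. -/
theorem exists_directions_of_injective {d n : ℕ} (f : hypercubeGraph d →g hypercubeGraph n)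
    (hf : Function.Injective f) :
    ∃ (σ : Fin d → Fin n) (x₀ : Fin n → Bool), Function.Injective σ ∧
      ∀ y, (∀ i, f y (σ i) = xor (x₀ (σ i)) (y i)) ∧ ∀ j, j ∉ Set.range σ → f y j = x₀ j := by
  have hstep : ∀ y i, ∃ p, f (flipAt y i) = flipAt (f y) p := fun y i =>
    hypercubeGraph_adj_iff.1 (f.map_adj (hypercubeGraph_adj_iff.2 ⟨i, rfl⟩))
  choose dir hdir using hstep
  set o : Fin d → Bool := fun _ => false with ho
  have hσ : Function.Injective (dir o) := by
    intro i j hij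
    have : f (flipAt o i) = f (flipAt o j) := by rw [hdir, hdir, hij]
    exact flipAt_injective o (hf this)
  -- flipping coordinate `i` upstairs always flips coordinate `dir o i` downstairs
  have key : ∀ (k : ℕ) (y : Fin d → Bool) (i : Fin d),
      (Finset.univ.filter fun j => y j = true).card = k → y i = false → dir y i = dir o i := by
    intro k
    induction k with
    | zero =>
      intro y i hy _
      have : y = o := by
        funext j
        rw [Finset.card_eq_zero, Finset.filter_eq_empty_iff] at hy
        simpa using hy (Finset.mem_univ j)
      rw [this]
    | succ k ih =>
      intro y i hy hi
      obtain ⟨j, hj⟩ : (Finset.univ.filter fun j => y j = true).Nonempty := by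
        rw [← Finset.card_pos]; omega
      have hj' : y j = true := by simpa using hj
      have hij : i ≠ j := by rintro rfl; simp [hi] at hj'
      set z := flipAt y j with hz
      have hyz : y = flipAt z j := (flipAt_flipAt y j).symm
      have hzj : z j = false := by simp [hz, hj']
      have hzi : z i = false := by rw [hz, flipAt_of_ne _ hij, hi]
      have hzk : (Finset.univ.filter fun l => z l = true).card = k := by
        rw [hz, card_filter_flipAt hj', hy]; rfl
      have h1 := ih z j hzk hzj
      have h2 := ih z i hzk hzi
      have hcomm : flipAt y i = flipAt (flipAt z i) j := by
        rw [hyz]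
        funext l
        by_cases hl : l = i
        · subst hl; simp [flipAt_of_ne _ hij]
        · by_cases hl' : l = j
          · subst hl'; simp [flipAt_of_ne _ hl]
          · simp [flipAt_of_ne, hl, hl']
      -- `z`, its flips at `i` and at `j`, and `flipAt y i` form a 4-cycle. Comparing the two routes
      -- through its image carries the direction of the edge at `z` over to the opposite edge at
      -- `y`.
      have e1 : f (flipAt y i) = flipAt (flipAt (f z) (dir o j)) (dir y i) := by
        rw [hdir y i, ← h1, ← hdir z j, ← hyz]
      have e2 : f (flipAt y i) = flipAt (flipAt (f z) (dir o i)) (dir (flipAt z i) j) := by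
        rw [hcomm, hdir (flipAt z i) j, hdir z i, h2]
      refine flipAt_square (z := f z) (fun h => hij (hσ h).symm) (e1.symm.trans e2) ?_
      rw [← e1]
      intro h
      have := congrFun (hf h) i
      rw [flipAt_self, hi, hzi] at this
      simp at this
  refine ⟨dir o, f o, hσ, ?_⟩
  have main : ∀ (k : ℕ) (y : Fin d → Bool),
      (Finset.univ.filter fun j => y j = true).card = k →
      (∀ i, f y (dir o i) = xor (f o (dir o i)) (y i)) ∧
        ∀ j, j ∉ Set.range (dir o) → f y j = f o j := by
    intro k
    induction k with
    | zero =>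
      intro y hy
      have : y = o := by
        funext j
        rw [Finset.card_eq_zero, Finset.filter_eq_empty_iff] at hy
        simpa using hy (Finset.mem_univ j)
      subst this
      simp [ho]
    | succ k ih =>
      intro y hy
      obtain ⟨j, hj⟩ : (Finset.univ.filter fun j => y j = true).Nonempty := by
        rw [← Finset.card_pos]; omega
      have hj' : y j = true := by simpa using hj
      set z := flipAt y j with hz
      have hyz : y = flipAt z j := (flipAt_flipAt y j).symm
      have hzj : z j = false := by simp [hz, hj']
      have hzk : (Finset.univ.filter fun l => z l = true).card = k := by
        rw [hz, card_filter_flipAt hj', hy]; rfl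
      obtain ⟨ih1, ih2⟩ := ih z hzk
      have hfy : f y = flipAt (f z) (dir o j) := by
        conv_lhs => rw [hyz]
        rw [hdir, key k z j hzk hzj]
      constructor
      · intro i
        rw [hfy]
        by_cases hij : i = j
        · subst hij; simp [ih1, hzj, hj']
        · rw [flipAt_of_ne _ (fun h => hij (hσ h)), ih1, hz, flipAt_of_ne _ hij]
      · intro l hl
        rw [hfy, flipAt_of_ne, ih2 l hl]
        rintro rfl
        exact hl ⟨j, rfl⟩
  exact fun y => main _ y rfl

/-- The indicator vector of a set of coordinates. -/
def indicatorVector {n : ℕ} (A : Finset (Fin n)) : Fin n → Bool := fun i => decide (i ∈ A)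

/-- `T` is the set of moving coordinates and `S` the set of fixed coordinates with value one. The
base point restricted to `T` is absorbed by a reflection of the d-cube. -/
theorem exists_stem_of_injective {d n : ℕ} (f : hypercubeGraph d →g hypercubeGraph n)
    (hf : Function.Injective f) :
    ∃ S T : Finset (Fin n), Disjoint S T ∧ T.card = d ∧ ∀ U ⊆ T, ∀ t ∈ T, t ∉ U →
      ∃ y y', (hypercubeGraph d).Adj y y' ∧ f y = indicatorVector (S ∪ U) ∧
        f y' = indicatorVector (insert t (S ∪ U)) := by
  classical
  obtain ⟨σ, x₀, hσ, h⟩ := exists_directions_of_injective f hf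
  set T := Finset.univ.image σ with hT
  have hmT : ∀ j, j ∈ T ↔ j ∈ Set.range σ := by simp [hT]
  set S := Finset.univ.filter fun j => j ∉ T ∧ x₀ j = true with hS
  have hST : Disjoint S T := by
    rw [Finset.disjoint_left]
    intro j hj
    exact (Finset.mem_filter.1 hj).2.1
  have hy : ∀ U ⊆ T, f (fun i => xor (x₀ (σ i)) (decide (σ i ∈ U))) = indicatorVector (S ∪ U) := by
    intro U hU
    funext j
    by_cases hj : j ∈ Set.range σ
    · obtain ⟨i, rfl⟩ := hj
      have : σ i ∉ S := fun hi => Finset.disjoint_left.1 hST hi ((hmT _).2 ⟨i, rfl⟩)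
      rw [(h _).1 i]
      simp [indicatorVector, this]
    · have h1 : j ∉ U := fun hj' => hj ((hmT _).1 (hU hj'))
      have h2 : j ∉ T := fun hj' => hj ((hmT _).1 hj')
      rw [(h _).2 j hj]
      simp [indicatorVector, h1, hS, h2]
  refine ⟨S, T, hST, by simp [hT, Finset.card_image_of_injective _ hσ], ?_⟩
  intro U hU t ht htU
  refine ⟨_, _, ?_, hy U hU, (hy (insert t U) (Finset.insert_subset ht hU)).trans ?_⟩
  · obtain ⟨i, rfl⟩ := (hmT _).1 ht
    rw [hypercubeGraph_adj_iff]
    refine ⟨i, ?_⟩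
    funext j
    by_cases hj : j = i
    · subst hj; simp [htU]
    · simp [flipAt_of_ne _ hj, hσ.ne hj]
  · rw [Finset.union_insert]

/-! ### Transversals given by families of lower ends. -/

/-- A subgraph isomorphic to Q_d is the image of an injective homomorphism. In this form the
condition passes through composition with an embedding of cubes. -/
theorem meetsEveryCube_iff {d n : ℕ} {G : (hypercubeGraph n).Subgraph} :
    MeetsEveryCube d G ↔ ∀ f : hypercubeGraph d →g hypercubeGraph n, Function.Injective f →
      ∃ y y', (hypercubeGraph d).Adj y y' ∧ G.Adj (f y) (f y') := by
  constructor
  · intro h f hf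
    let F : SimpleGraph.Copy (hypercubeGraph d) (hypercubeGraph n) := ⟨f, hf⟩
    obtain ⟨e, heG, heH⟩ := h F.toSubgraph ⟨F.isoToSubgraph.symm⟩
    induction e using Sym2.ind with
    | _ x y =>
      rw [SimpleGraph.Subgraph.mem_edgeSet] at heG heH
      simp only [SimpleGraph.Copy.toSubgraph, SimpleGraph.Subgraph.map_adj, Relation.Map] at heH
      obtain ⟨a, b, hab, rfl, rfl⟩ := heH
      exact ⟨a, b, hab, heG⟩
  · rintro h H ⟨φ⟩
    obtain ⟨y, y', hyy, hG⟩ := h (H.hom.comp φ.symm.toHom)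
      (H.hom_injective.comp φ.symm.injective)
    exact ⟨s(_, _), hG, φ.symm.map_adj_iff.2 hyy⟩

theorem indicatorVector_injective {n : ℕ} :
    Function.Injective (indicatorVector : Finset (Fin n) → Fin n → Bool) := by
  intro A B h
  ext i
  simpa [indicatorVector] using congrFun h i

theorem indicatorVector_adj_insert {n : ℕ} {A : Finset (Fin n)} {i : Fin n} (hi : i ∉ A) :
    (hypercubeGraph n).Adj (indicatorVector A) (indicatorVector (insert i A)) := by
  rw [hypercubeGraph_adj_iff]
  refine ⟨i, ?_⟩
  funext j
  by_cases hj : j = i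
  · subst hj; simp [indicatorVector, hi]
  · simp [flipAt_of_ne _ hj, indicatorVector, hj]

/-- The spanning subgraph of the cube consisting of the edges whose lower end is in `P`. -/
def lowerEndGraph {n : ℕ} (P : Finset (Fin n) → Prop) : (hypercubeGraph n).Subgraph where
  verts := Set.univ
  Adj x y := (hypercubeGraph n).Adj x y ∧ P (Finset.univ.filter fun i => x i = true ∧ y i = true)
  adj_sub h := h.1
  edge_vert _ := Set.mem_univ _
  symm := ⟨fun x y h => ⟨h.1.symm, by simpa only [and_comm] using h.2⟩⟩

theorem lowerEndGraph_adj_insert {n : ℕ} {P : Finset (Fin n) → Prop} {A : Finset (Fin n)}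
    {i : Fin n} (hi : i ∉ A) :
    (lowerEndGraph P).Adj (indicatorVector A) (indicatorVector (insert i A)) ↔ P A := by
  have : (Finset.univ.filter fun j =>
      indicatorVector A j = true ∧ indicatorVector (insert i A) j = true) = A := by
    ext j
    simp +contextual [indicatorVector]
  simp only [lowerEndGraph, this, indicatorVector_adj_insert hi, true_and]

theorem exists_insert_of_adj {n : ℕ} {x y : Fin n → Bool} (h : (hypercubeGraph n).Adj x y) :
    ∃ (A : Finset (Fin n)) (i : Fin n), i ∉ A ∧
      s(x, y) = s(indicatorVector A, indicatorVector (insert i A)) := by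
  have aux : ∀ (z : Fin n → Bool) (i : Fin n), z i = false → ∃ A : Finset (Fin n), i ∉ A ∧
      indicatorVector A = z ∧ indicatorVector (insert i A) = flipAt z i := by
    intro z i hi
    refine ⟨Finset.univ.filter fun j => z j = true, by simp [hi], ?_, ?_⟩
    · funext j; simp [indicatorVector]
    · funext j
      by_cases hj : j = i
      · subst hj; simp [indicatorVector, hi]
      · simp [indicatorVector, flipAt_of_ne _ hj, hj]
  obtain ⟨i, rfl⟩ := hypercubeGraph_adj_iff.1 h
  cases hxi : x i
  · obtain ⟨A, hA, h1, h2⟩ := aux x i hxi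
    exact ⟨A, i, hA, by rw [h1, h2]⟩
  · obtain ⟨A, hA, h1, h2⟩ := aux (flipAt x i) i (by simp [hxi])
    exact ⟨A, i, hA, by rw [h1, h2, flipAt_flipAt, Sym2.eq_swap]⟩

open Classical in
-- An edge is determined by its lower end `A` and its direction, which is any element of the
-- complement of `A`.
theorem ncard_edgeSet_lowerEndGraph {n : ℕ} (P : Finset (Fin n) → Prop) :
    (lowerEndGraph P).edgeSet.ncard
      = ∑ A ∈ Finset.univ.filter P, (n - A.card) := by
  set E : Finset (Σ _ : Finset (Fin n), Fin n) := (Finset.univ.filter P).sigma fun A => Aᶜ with hE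
  set ε : (Σ _ : Finset (Fin n), Fin n) → Sym2 (Fin n → Bool) := fun p =>
    s(indicatorVector p.1, indicatorVector (insert p.2 p.1)) with hε
  have hset : (lowerEndGraph P).edgeSet = ε '' E := by
    ext e
    constructor
    · intro he
      induction e using Sym2.ind with
      | _ x y =>
        obtain ⟨A, i, hi, hA⟩ := exists_insert_of_adj (SimpleGraph.Subgraph.mem_edgeSet.1 he).adj_sub
        rw [hA] at he ⊢
        exact ⟨⟨A, i⟩, by simpa [hE, hi] using (lowerEndGraph_adj_insert hi).1 he, rfl⟩
    · rintro ⟨⟨A, i⟩, hAi, rfl⟩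
      simp only [hE, Finset.mem_coe, Finset.mem_sigma, Finset.mem_filter, Finset.mem_univ, true_and,
        Finset.mem_compl] at hAi
      exact (lowerEndGraph_adj_insert hAi.2).2 hAi.1
  have hinj : Set.InjOn ε E := by
    rintro ⟨A, i⟩ hAi ⟨B, j⟩ hBj h
    simp only [hE, Finset.mem_coe, Finset.mem_sigma, Finset.mem_filter, Finset.mem_univ, true_and,
      Finset.mem_compl] at hAi hBj
    simp only [hε, Sym2.eq_iff, indicatorVector_injective.eq_iff] at h
    rcases h with ⟨rfl, h⟩ | ⟨h1, h2⟩
    · have : i ∈ insert j A := h ▸ Finset.mem_insert_self i A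
      have hij : i = j := (Finset.mem_insert.1 this).resolve_right hAi.2
      rw [hij]
    · have c1 := congrArg Finset.card h1
      have c2 := congrArg Finset.card h2
      rw [Finset.card_insert_of_notMem hBj.2] at c1
      rw [Finset.card_insert_of_notMem hAi.2] at c2
      omega
  rw [hset, hinj.ncard_image, Set.ncard_coe_finset, hE, Finset.card_sigma]
  simp [Finset.card_compl]

theorem ncard_edgeSet_hypercubeGraph (n : ℕ) :
    (hypercubeGraph n).edgeSet.ncard = ∑ A : Finset (Fin n), (n - A.card) := by
  classical
  have h : (hypercubeGraph n).edgeSet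
      = (lowerEndGraph (n := n) fun _ => True).edgeSet := by
    ext e
    induction e using Sym2.ind with
    | _ x y => simp [lowerEndGraph]
  rw [h, ncard_edgeSet_lowerEndGraph]
  simp

/-- A family of sets that contains, for every stem `S` and every `d`-set `T` disjoint from `S`, a
set `S ∪ U` with `U ⊂ T`, provides an edge transversal. -/
theorem meetsEveryCube_lowerEndGraph {n d : ℕ} {P : Finset (Fin n) → Prop}
    (h : ∀ S T : Finset (Fin n), Disjoint S T → T.card = d → ∃ U ⊂ T, P (S ∪ U)) :
    MeetsEveryCube d (lowerEndGraph P) := by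
  rw [meetsEveryCube_iff]
  intro f hf
  obtain ⟨S, T, hST, hT, hfST⟩ := exists_stem_of_injective f hf
  obtain ⟨U, hU, hP⟩ := h S T hST hT
  obtain ⟨t, htT, htU⟩ := Finset.exists_of_ssubset hU
  obtain ⟨y, y', hyy, h1, h2⟩ := hfST U hU.subset t htT htU
  refine ⟨y, y', hyy, ?_⟩
  rw [h1, h2, lowerEndGraph_adj_insert]
  · exact hP
  · simp only [Finset.mem_union, not_or]
    exact ⟨fun hS => Finset.disjoint_left.1 hST hS htT, htU⟩

theorem minEdgeTransversal_le {n d : ℕ} {G : (hypercubeGraph n).Subgraph}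
    (hG : MeetsEveryCube d G) : minEdgeTransversal n d ≤ G.edgeSet.ncard :=
  Nat.sInf_le ⟨G, hG, rfl⟩

/-- The edges whose lower end has a suitable parity form a transversal with at most half of all
edges. -/
theorem exists_parity_transversal (n : ℕ) {d : ℕ} (hd : 2 ≤ d) :
    ∃ G : (hypercubeGraph n).Subgraph, MeetsEveryCube d G ∧
      2 * G.edgeSet.ncard ≤ (hypercubeGraph n).edgeSet.ncard := by
  classical
  have hmeet : ∀ Q : ℕ → Prop, (∀ m, Q m ∨ Q (m + 1)) →
      MeetsEveryCube d (lowerEndGraph (n := n) fun A => Q A.card) := by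
    intro Q hQ
    refine meetsEveryCube_lowerEndGraph fun S T hST hT => ?_
    -- `U` is empty or a singleton, according to the parity of the stem; the singleton is a proper
    -- subset because `2 ≤ d`.
    rcases hQ S.card with h | h
    · refine ⟨∅, ?_, by simpa using h⟩
      rw [Finset.empty_ssubset, ← Finset.card_pos]; omega
    · obtain ⟨t, ht⟩ : T.Nonempty := by rw [← Finset.card_pos]; omega
      refine ⟨{t}, ?_, ?_⟩
      · rw [Finset.ssubset_iff_subset_ne]
        refine ⟨by simpa using ht, ?_⟩
        rintro rfl
        simp at hT; omega
      · rw [Finset.card_union_of_disjoint (by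
          simpa using fun hS => Finset.disjoint_left.1 hST hS ht)]
        simpa using h
  have h1 := hmeet Even fun m => by rw [Nat.even_add_one]; exact em _
  have h2 := hmeet (fun m => ¬ Even m) fun m => by rw [Nat.even_add_one]; tauto
  have hsum : (lowerEndGraph (n := n) fun A => Even A.card).edgeSet.ncard
      + (lowerEndGraph (n := n) fun A => ¬ Even A.card).edgeSet.ncard
        = (hypercubeGraph n).edgeSet.ncard := by
    rw [ncard_edgeSet_lowerEndGraph, ncard_edgeSet_lowerEndGraph, ncard_edgeSet_hypercubeGraph,
      ← Finset.sum_filter_add_sum_filter_not Finset.univ fun A : Finset (Fin n) => Even A.card]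
    congr!
  by_cases h : 2 * (lowerEndGraph (n := n) fun A => Even A.card).edgeSet.ncard
      ≤ (hypercubeGraph n).edgeSet.ncard
  · exact ⟨_, h1, h⟩
  · exact ⟨_, h2, by omega⟩

/-! ### The hyperplane construction over 𝔽₂. -/

/-- The vectors `v i`, `i ∈ A`, lie in a common hyperplane of `𝔽₂ᵐ`. -/
def InHyperplane {ι : Type*} {m : ℕ} (v : ι → Fin m → ZMod 2) (A : Finset ι) : Prop :=
  ∃ a : Fin m → ZMod 2, a ≠ 0 ∧ ∀ i ∈ A, a ⬝ᵥ v i = 0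

/-- Translation by a unit vector at a coordinate where `a` is nonzero exchanges the hyperplane and
its complement. -/
theorem two_mul_card_hyperplane {m : ℕ} {a : Fin m → ZMod 2} (ha : a ≠ 0) :
    2 * (Finset.univ.filter fun v : Fin m → ZMod 2 => a ⬝ᵥ v = 0).card = 2 ^ m := by
  obtain ⟨j, hj⟩ : ∃ j, a j ≠ 0 := Function.ne_iff.1 ha
  have two : ∀ c : ZMod 2, c = 0 ∨ c = 1 := by decide
  have hj1 : a j = 1 := (two _).resolve_left hj
  have h : (Finset.univ.filter fun v : Fin m → ZMod 2 => a ⬝ᵥ v = 0).card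
      = (Finset.univ.filter fun v : Fin m → ZMod 2 => ¬ a ⬝ᵥ v = 0).card := by
    refine Finset.card_equiv (Equiv.addRight (Pi.single j 1)) fun v => ?_
    simp only [Finset.mem_filter, Finset.mem_univ, true_and, Equiv.coe_addRight, dotProduct_add,
      dotProduct_single, hj1, mul_one]
    generalize a ⬝ᵥ v = c
    revert c
    decide
  have h2 := Finset.card_filter_add_card_filter_not (s := (Finset.univ : Finset (Fin m → ZMod 2)))
    (fun v => a ⬝ᵥ v = 0)
  rw [← h] at h2
  simp only [Finset.card_univ, Fintype.card_fun, ZMod.card, Fintype.card_fin] at h2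
  omega

/-- The conditions at the elements of `A` are independent, and each halves the number of choices. -/
theorem two_pow_mul_card_vectors_in_hyperplane {n m : ℕ} {a : Fin m → ZMod 2} (ha : a ≠ 0)
    (A : Finset (Fin n)) :
    2 ^ A.card * (Finset.univ.filter fun v : Fin n → Fin m → ZMod 2 =>
      ∀ i ∈ A, a ⬝ᵥ v i = 0).card = (2 ^ m) ^ n := by
  classical
  have h : (Finset.univ.filter fun v : Fin n → Fin m → ZMod 2 => ∀ i ∈ A, a ⬝ᵥ v i = 0)
      = Fintype.piFinset fun i => if i ∈ A then
          Finset.univ.filter fun v : Fin m → ZMod 2 => a ⬝ᵥ v = 0 else Finset.univ := by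
    ext v
    simp only [Finset.mem_filter, Finset.mem_univ, true_and, Fintype.mem_piFinset]
    refine forall_congr' fun i => ?_
    by_cases hi : i ∈ A <;> simp [hi]
  rw [h, Fintype.card_piFinset]
  have h2 : (2 : ℕ) ^ A.card = ∏ i : Fin n, if i ∈ A then 2 else 1 := by
    simp [Finset.prod_ite_mem]
  rw [h2, ← Finset.prod_mul_distrib]
  have : ∀ i : Fin n, (if i ∈ A then 2 else 1) * (if i ∈ A then
      Finset.univ.filter fun v : Fin m → ZMod 2 => a ⬝ᵥ v = 0 else Finset.univ).card = 2 ^ m := by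
    intro i
    by_cases hi : i ∈ A
    · simpa [hi] using two_mul_card_hyperplane ha
    · simp [hi, ZMod.card]
  rw [Finset.prod_congr rfl fun i _ => this i]
  simp

open Classical in
/-- For some choice of vectors, few `r`-sets lie in a hyperplane. -/
theorem exists_vectors_few_inHyperplane (n r s : ℕ) :
    ∃ v : Fin n → Fin (r - s) → ZMod 2,
      2 ^ s * ((Finset.univ.filter fun A : Finset (Fin n) => A.card = r).filter
        (InHyperplane v)).card ≤ (Finset.univ.filter fun A : Finset (Fin n) => A.card = r).card := by
  set X := Finset.univ.filter fun A : Finset (Fin n) => A.card = r with hX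
  rcases le_total r s with hrs | hrs
  -- Here `r - s` is zero by truncation, so there is no nonzero functional and no set counts as
  -- lying in a hyperplane.
  · refine ⟨fun _ _ => 0, ?_⟩
    rw [Finset.filter_eq_empty_iff.2]
    · simp
    · rintro A - ⟨a, ha, -⟩
      apply ha
      funext i
      have := i.2
      omega
  set m := r - s with hm
  by_contra! hcon
  set V := Fin n → Fin m → ZMod 2
  have hcardV : Fintype.card V = (2 ^ m) ^ n := by
    simp [V, ZMod.card]
  -- every `r`-set lies in a hyperplane for few choices
  have hA : ∀ A ∈ X, 2 ^ r * (Finset.univ.filter fun v : V => InHyperplane v A).card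
      ≤ 2 ^ m * (2 ^ m) ^ n := by
    intro A hA
    have hAr : A.card = r := (Finset.mem_filter.1 hA).2
    have hsub : (Finset.univ.filter fun v : V => InHyperplane v A) ⊆
        (Finset.univ.filter fun a : Fin m → ZMod 2 => a ≠ 0).biUnion fun a =>
          Finset.univ.filter fun v : V => ∀ i ∈ A, a ⬝ᵥ v i = 0 := by
      intro v hv
      obtain ⟨a, ha, hav⟩ := (Finset.mem_filter.1 hv).2
      simp only [Finset.mem_biUnion, Finset.mem_filter, Finset.mem_univ, true_and]
      exact ⟨a, ha, hav⟩
    -- Union bound over the nonzero functionals: each annihilates all of `A` for a proportion 2⁻ʳ of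
    -- the choices.
    calc 2 ^ r * (Finset.univ.filter fun v : V => InHyperplane v A).card
        ≤ 2 ^ r * ∑ a ∈ Finset.univ.filter fun a : Fin m → ZMod 2 => a ≠ 0,
            (Finset.univ.filter fun v : V => ∀ i ∈ A, a ⬝ᵥ v i = 0).card :=
          Nat.mul_le_mul_left _ ((Finset.card_le_card hsub).trans Finset.card_biUnion_le)
      _ = ∑ a ∈ Finset.univ.filter fun a : Fin m → ZMod 2 => a ≠ 0, (2 ^ m) ^ n := by
          rw [Finset.mul_sum]
          refine Finset.sum_congr rfl fun a ha => ?_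
          rw [← hAr]
          exact two_pow_mul_card_vectors_in_hyperplane (Finset.mem_filter.1 ha).2 A
      _ ≤ ∑ _a : Fin m → ZMod 2, (2 ^ m) ^ n :=
          Finset.sum_le_sum_of_subset (Finset.filter_subset _ _)
      _ = 2 ^ m * (2 ^ m) ^ n := by simp [ZMod.card]
  -- Double counting of pairs of a choice and an `r`-set: if every choice were bad, the sum over all
  -- choices would exceed the bound in `hA`.
  have hswap : ∑ v : V, (X.filter (InHyperplane v)).card
      = ∑ A ∈ X, (Finset.univ.filter fun v : V => InHyperplane v A).card := by
    simp only [Finset.card_filter]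
    exact Finset.sum_comm
  have hlt : ∑ _v : V, X.card < ∑ v : V, 2 ^ s * (X.filter (InHyperplane v)).card := by
    apply Finset.sum_lt_sum_of_nonempty
    · exact Finset.univ_nonempty
    · exact fun v _ => hcon v
  rw [← Finset.mul_sum, hswap, Finset.sum_const, Finset.card_univ, hcardV, smul_eq_mul] at hlt
  have hle : 2 ^ r * ∑ A ∈ X, (Finset.univ.filter fun v : V => InHyperplane v A).card
      ≤ X.card * (2 ^ m * (2 ^ m) ^ n) := by
    rw [Finset.mul_sum]
    simpa using Finset.sum_le_sum hA
  have hr : 2 ^ r = 2 ^ m * 2 ^ s := by rw [← pow_add, hm]; congr 1; omega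
  rw [hr] at hle
  have hpos : 0 < 2 ^ m := by positivity
  have := Nat.mul_lt_mul_of_pos_left hlt hpos
  nlinarith

/-- If the stem spans a subspace of codimension at least two, some hyperplane through it contains a
third of any given further vectors. -/
theorem exists_subset_inHyperplane {n m k : ℕ} (v : Fin n → Fin m → ZMod 2)
    {S T : Finset (Fin n)} (hS : S.card + 2 ≤ m) (hT : 3 * k < T.card + 3) :
    ∃ U ⊆ T, U.card = k ∧ InHyperplane v (S ∪ U) := by
  classical
  -- The kernel of `L` is the annihilator of the stem; its dimension is at least `m - S.card`, hence
  -- at least two.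
  let L : (Fin m → ZMod 2) →ₗ[ZMod 2] (S → ZMod 2) :=
    LinearMap.pi fun i => LinearMap.flip (dotProductBilin (ZMod 2) (ZMod 2)) (v i)
  have hL : ∀ a, a ∈ LinearMap.ker L ↔ ∀ i ∈ S, a ⬝ᵥ v i = 0 := by
    intro a
    rw [LinearMap.mem_ker, funext_iff]
    simp [L]
  have hrank : 2 ≤ Module.finrank (ZMod 2) (LinearMap.ker L) := by
    have h1 := LinearMap.finrank_range_add_finrank_ker L
    have h2 : Module.finrank (ZMod 2) (LinearMap.range L) ≤ S.card := by
      refine (Submodule.finrank_le _).trans ?_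
      simp
    simp only [Module.finrank_fintype_fun_eq_card, Fintype.card_fin] at h1
    omega
  obtain ⟨w, hw⟩ := exists_linearIndependent_of_le_finrank hrank
  have hp := LinearIndependent.pair_iff.1 (show LinearIndependent (ZMod 2) ![w 0, w 1] by
    convert hw using 1; funext i; fin_cases i <;> rfl)
  set a : Fin m → ZMod 2 := (w 0).1 with ha
  set b : Fin m → ZMod 2 := (w 1).1 with hb
  have key : ∀ c e : ZMod 2, c • a + e • b = 0 → c = 0 ∧ e = 0 := fun c e h =>
    hp c e (Subtype.ext (by simpa using h))
  have ha0 : a ≠ 0 := fun h => by simpa using key 1 0 (by simp [h])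
  have hb0 : b ≠ 0 := fun h => by simpa using key 0 1 (by simp [h])
  have hab0 : a + b ≠ 0 := fun h => by simpa using key 1 1 (by simp [h])
  have haS := (hL a).1 (w 0).2
  have hbS := (hL b).1 (w 1).2
  have finish : ∀ c : Fin m → ZMod 2, c ≠ 0 → (∀ i ∈ S, c ⬝ᵥ v i = 0) →
      k ≤ (T.filter fun i => c ⬝ᵥ v i = 0).card →
      ∃ U ⊆ T, U.card = k ∧ InHyperplane v (S ∪ U) := by
    intro c hc hcS hck
    obtain ⟨U, hU, hUk⟩ := Finset.exists_subset_card_eq hck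
    refine ⟨U, hU.trans (Finset.filter_subset _ _), hUk, c, hc, fun i hi => ?_⟩
    rcases Finset.mem_union.1 hi with h | h
    · exact hcS i h
    · exact (Finset.mem_filter.1 (hU h)).2
  -- Among two elements of 𝔽₂ and their sum, at least one is zero.
  have hcover : T ⊆ ((T.filter fun i => a ⬝ᵥ v i = 0) ∪ T.filter fun i => b ⬝ᵥ v i = 0)
      ∪ T.filter fun i => (a + b) ⬝ᵥ v i = 0 := by
    intro i hi
    simp only [Finset.mem_union, Finset.mem_filter, hi, true_and, add_dotProduct]
    generalize a ⬝ᵥ v i = c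
    generalize b ⬝ᵥ v i = e
    revert c e
    decide
  have hcard := (Finset.card_le_card hcover).trans ((Finset.card_union_le _ _).trans
    (Nat.add_le_add_right (Finset.card_union_le _ _) _))
  by_cases h1 : k ≤ (T.filter fun i => a ⬝ᵥ v i = 0).card
  · exact finish a ha0 haS h1
  by_cases h2 : k ≤ (T.filter fun i => b ⬝ᵥ v i = 0).card
  · exact finish b hb0 hbS h2
  · refine finish (a + b) hab0 (fun i hi => ?_) (by omega)
    rw [add_dotProduct, haS i hi, hbS i hi, add_zero]

/-- There is an edge transversal for `d`-cubes with a proportion `2⁻ˢ` of all edges. -/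
theorem exists_hyperplane_transversal (n : ℕ) {d s : ℕ} (hs : 3 * (s + 1) < d) :
    ∃ G : (hypercubeGraph n).Subgraph, MeetsEveryCube d G ∧
      2 ^ s * G.edgeSet.ncard ≤ (hypercubeGraph n).edgeSet.ncard := by
  classical
  choose v hv using fun r => exists_vectors_few_inHyperplane n r s
  refine ⟨lowerEndGraph fun A => InHyperplane (v A.card) A,
    meetsEveryCube_lowerEndGraph fun S T hST hT => ?_, ?_⟩
  -- With `s + 2` added elements the layer is `r = S.card + s + 2`, so the dimension `r - s` exceeds
  -- the size of the stem by exactly two.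
  · obtain ⟨U, hU, hUk, hP⟩ := exists_subset_inHyperplane (k := s + 2) (v (S.card + (s + 2)))
      (S := S) (T := T) (by omega) (by omega)
    refine ⟨U, ?_, ?_⟩
    · refine Finset.ssubset_iff_subset_ne.2 ⟨hU, ?_⟩
      rintro rfl
      omega
    · have : (S ∪ U).card = S.card + (s + 2) := by
        rw [Finset.card_union_of_disjoint (hST.mono_right hU), hUk]
      rw [this]
      exact hP
  · rw [ncard_edgeSet_lowerEndGraph, ncard_edgeSet_hypercubeGraph]
    have hmaps : ∀ Y : Finset (Finset (Fin n)), ∀ A ∈ Y, A.card ∈ Finset.range (n + 1) := by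
      intro Y A _
      rw [Finset.mem_range, Nat.lt_succ_iff]
      simpa using Finset.card_le_univ A
    -- The comparison is made layer by layer: every set of size `r` is the lower end of the same
    -- number `n - r` of edges.
    rw [← Finset.sum_fiberwise_of_maps_to (hmaps _), ← Finset.sum_fiberwise_of_maps_to (hmaps _),
      Finset.mul_sum]
    refine Finset.sum_le_sum fun r _ => ?_
    have hconst : ∀ Y : Finset (Finset (Fin n)),
        ∑ A ∈ Y with A.card = r, (n - A.card) = (Y.filter fun A => A.card = r).card * (n - r) := by
      intro Y
      rw [Finset.sum_congr rfl fun A hA => by rw [(Finset.mem_filter.1 hA).2], Finset.sum_const,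
        smul_eq_mul]
    rw [hconst, hconst, ← mul_assoc]
    refine Nat.mul_le_mul_right _ ?_
    convert hv r using 3
    ext A
    simp only [Finset.mem_filter, Finset.mem_univ, true_and]
    constructor
    · rintro ⟨h, rfl⟩; exact ⟨rfl, h⟩
    · rintro ⟨rfl, h⟩; exact ⟨h, rfl⟩

/-! ### Facets and monotonicity of the ratio. -/

theorem flipAt_insertNth {n : ℕ} (i : Fin (n + 1)) (b : Bool) (x : Fin n → Bool) (j : Fin n) :
    flipAt (i.insertNth b x : Fin (n + 1) → Bool) (i.succAbove j)
      = i.insertNth b (flipAt x j) := by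
  funext l
  induction l using i.succAboveCases with
  | x => simp [flipAt_of_ne _ (Fin.ne_succAbove i j)]
  | p l =>
    by_cases h : l = j
    · subst h; simp
    · rw [flipAt_of_ne _ (fun h' => h (Fin.succAbove_right_injective h'))]
      simp [flipAt_of_ne _ h]

theorem insertNth_bool_injective {n : ℕ} (i : Fin (n + 1)) (b : Bool) :
    Function.Injective fun x : Fin n → Bool => (i.insertNth b x : Fin (n + 1) → Bool) := by
  intro x y h
  funext l
  simpa using congrFun h (i.succAbove l)

/-- The embedding of the `n`-cube as a facet of the `n + 1`-cube. -/
def facetHom {n : ℕ} (i : Fin (n + 1)) (b : Bool) :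
    hypercubeGraph n →g hypercubeGraph (n + 1) where
  toFun x := i.insertNth b x
  map_rel' {x y} h := by
    obtain ⟨j, rfl⟩ := hypercubeGraph_adj_iff.1 h
    exact hypercubeGraph_adj_iff.2 ⟨i.succAbove j, (flipAt_insertNth i b x j).symm⟩

theorem facetHom_injective {n : ℕ} (i : Fin (n + 1)) (b : Bool) :
    Function.Injective (facetHom i b) :=
  insertNth_bool_injective i b

theorem adj_of_facetHom_adj {n : ℕ} {i : Fin (n + 1)} {b : Bool} {x y : Fin n → Bool}
    (h : (hypercubeGraph (n + 1)).Adj (facetHom i b x) (facetHom i b y)) :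
    (hypercubeGraph n).Adj x y := by
  obtain ⟨l, hl⟩ := hypercubeGraph_adj_iff.1 h
  change (i.insertNth b y : Fin (n + 1) → Bool) = flipAt (i.insertNth b x) l at hl
  have hli : l ≠ i := by
    rintro rfl
    simpa using congrFun hl l
  obtain ⟨j, rfl⟩ := Fin.exists_succAbove_eq hli
  rw [flipAt_insertNth] at hl
  exact hypercubeGraph_adj_iff.2 ⟨j, insertNth_bool_injective i b hl⟩

theorem meetsEveryCube_comap_facetHom {n d : ℕ} {G : (hypercubeGraph (n + 1)).Subgraph}
    (hG : MeetsEveryCube d G) (i : Fin (n + 1)) (b : Bool) :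
    MeetsEveryCube d (G.comap (facetHom i b)) := by
  rw [meetsEveryCube_iff] at hG ⊢
  intro f hf
  obtain ⟨y, y', hyy, h⟩ := hG ((facetHom i b).comp f) ((facetHom_injective i b).comp hf)
  exact ⟨y, y', hyy, f.map_adj hyy, h⟩

theorem ncard_edgeSet_comap_facetHom {n : ℕ} (G : (hypercubeGraph (n + 1)).Subgraph)
    (i : Fin (n + 1)) (b : Bool) :
    (G.comap (facetHom i b)).edgeSet.ncard = {e ∈ G.edgeSet | ∀ x ∈ e, x i = b}.ncard := by
  rw [← Set.ncard_image_of_injective _ (Sym2.map.injective (facetHom_injective i b))]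
  congr 1
  ext e
  constructor
  · rintro ⟨e, he, rfl⟩
    induction e using Sym2.ind with
    | _ x y =>
      refine ⟨he.2, ?_⟩
      simp [facetHom]
  · rintro ⟨he, hb⟩
    induction e using Sym2.ind with
    | _ x y =>
      have aux : ∀ z : Fin (n + 1) → Bool, z i = b → facetHom i b (i.removeNth z) = z := by
        rintro z rfl
        exact Fin.insertNth_self_removeNth i z
      have hx := aux x (hb x (by simp))
      have hy := aux y (hb y (by simp))
      have hGxy : G.Adj x y := he
      refine ⟨s(i.removeNth x, i.removeNth y), ?_, by rw [Sym2.map_mk, hx, hy]⟩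
      have hG' : G.Adj (facetHom i b (i.removeNth x)) (facetHom i b (i.removeNth y)) := by
        rw [hx, hy]; exact hGxy
      exact ⟨adj_of_facetHom_adj hG'.adj_sub, hG'⟩

/-- Every edge of the `n + 1`-cube lies in exactly `n` facets. -/
theorem sum_ncard_edgeSet_comap_facetHom {n : ℕ} (G : (hypercubeGraph (n + 1)).Subgraph) :
    ∑ p : Fin (n + 1) × Bool, (G.comap (facetHom p.1 p.2)).edgeSet.ncard
      = n * G.edgeSet.ncard := by
  classical
  have hE : ∀ q : Sym2 (Fin (n + 1) → Bool) → Prop,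
      {e ∈ G.edgeSet | q e}.ncard = ∑ e ∈ G.edgeSet.toFinset, if q e then 1 else 0 := by
    intro q
    rw [← Finset.card_filter, ← Set.ncard_coe_finset]
    congr 1
    ext e
    simp
  simp only [ncard_edgeSet_comap_facetHom, hE]
  rw [Finset.sum_comm, Set.ncard_eq_toFinset_card', mul_comm, ← smul_eq_mul]
  refine Finset.sum_eq_card_nsmul fun e he => ?_
  rw [Set.mem_toFinset] at he
  induction e using Sym2.ind with
  | _ x y =>
    obtain ⟨l, rfl⟩ := hypercubeGraph_adj_iff.1 (SimpleGraph.Subgraph.mem_edgeSet.1 he).adj_sub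
    rw [Fintype.sum_prod_type]
    dsimp only
    -- An edge of direction `l` lies in one of the two facets orthogonal to `i` if `i ≠ l`, and in
    -- neither if `i = l`.
    have hi : ∀ i : Fin (n + 1), (∑ b : Bool,
        if ∀ z ∈ s(x, flipAt x l), z i = b then 1 else 0) = if i ≠ l then 1 else 0 := by
      intro i
      by_cases h : i = l
      · subst h; cases hx : x i <;> simp [hx]
      · cases hx : x i <;> simp [flipAt_of_ne _ h, h, hx]
    trans ∑ i : Fin (n + 1), if i ≠ l then 1 else 0
    · refine Finset.sum_congr rfl fun i _ => ?_
      convert hi i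
    rw [← Finset.card_filter, Finset.filter_ne']
    simp

/-- The facet count for the whole cube. It has the same factors as the inequality for minimal
transversals, so the two can be divided without a closed formula for e(Q_n). -/
theorem mul_ncard_edgeSet_hypercubeGraph_succ (n : ℕ) :
    n * (hypercubeGraph (n + 1)).edgeSet.ncard
      = 2 * (n + 1) * (hypercubeGraph n).edgeSet.ncard := by
  have h := sum_ncard_edgeSet_comap_facetHom (⊤ : (hypercubeGraph (n + 1)).Subgraph)
  have htop : ∀ p : Fin (n + 1) × Bool,
      ((⊤ : (hypercubeGraph (n + 1)).Subgraph).comap (facetHom p.1 p.2)).edgeSet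
        = (hypercubeGraph n).edgeSet := by
    intro p
    ext e
    induction e using Sym2.ind with
    | _ x y =>
      exact ⟨fun h => h.1, fun h => ⟨h, (facetHom p.1 p.2).map_adj h⟩⟩
  simp only [htop, SimpleGraph.Subgraph.edgeSet_top] at h
  rw [← h, Finset.sum_const]
  rw [Finset.card_univ, Fintype.card_prod, Fintype.card_fin, Fintype.card_bool, smul_eq_mul]
  ring

theorem exists_minEdgeTransversal (n : ℕ) {d : ℕ} (hd : 2 ≤ d) :
    ∃ G : (hypercubeGraph n).Subgraph, MeetsEveryCube d G ∧
      G.edgeSet.ncard = minEdgeTransversal n d := by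
  obtain ⟨G, hG, -⟩ := exists_parity_transversal n hd
  exact Nat.sInf_mem (s := {m : ℕ | ∃ G : (hypercubeGraph n).Subgraph,
    MeetsEveryCube d G ∧ G.edgeSet.ncard = m}) ⟨_, G, hG, rfl⟩

/-- Each of the 2(n+1) facets inherits a transversal from a minimal one, and each edge is counted
`n` times. -/
theorem two_mul_minEdgeTransversal_le (n : ℕ) {d : ℕ} (hd : 2 ≤ d) :
    2 * (n + 1) * minEdgeTransversal n d ≤ n * minEdgeTransversal (n + 1) d := by
  obtain ⟨G, hG, hcard⟩ := exists_minEdgeTransversal (n + 1) hd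
  rw [← hcard, ← sum_ncard_edgeSet_comap_facetHom]
  have := Finset.card_nsmul_le_sum (Finset.univ : Finset (Fin (n + 1) × Bool))
    (fun p => (G.comap (facetHom p.1 p.2)).edgeSet.ncard) (minEdgeTransversal n d)
    fun p _ => minEdgeTransversal_le (meetsEveryCube_comap_facetHom hG p.1 p.2)
  refine le_trans (le_of_eq ?_) this
  rw [Finset.card_univ, Fintype.card_prod, Fintype.card_fin, Fintype.card_bool, smul_eq_mul]
  ring

theorem ncard_edgeSet_hypercubeGraph_pos {n : ℕ} (hn : n ≠ 0) :
    0 < (hypercubeGraph n).edgeSet.ncard := by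
  rw [ncard_edgeSet_hypercubeGraph]
  exact Finset.sum_pos' (fun _ _ => Nat.zero_le _) ⟨∅, Finset.mem_univ _, by simp; omega⟩

theorem edgeTransversalRatio_nonneg (d n : ℕ) : 0 ≤ edgeTransversalRatio d n := by
  unfold edgeTransversalRatio
  positivity

theorem edgeTransversalRatio_monotone {d : ℕ} (hd : 2 ≤ d) :
    Monotone (edgeTransversalRatio d) := by
  refine monotone_nat_of_le_succ fun n => ?_
  rcases eq_or_ne n 0 with rfl | hn
  -- The 0-cube has no edges, so its ratio is zero by the convention for division by zero.
  · have : (hypercubeGraph 0).edgeSet.ncard = 0 := by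
      rw [ncard_edgeSet_hypercubeGraph]
      simp
    refine le_trans (le_of_eq ?_) (edgeTransversalRatio_nonneg d _)
    simp [edgeTransversalRatio, this]
  · have h1 := mul_ncard_edgeSet_hypercubeGraph_succ n
    have h2 := two_mul_minEdgeTransversal_le n hd
    have p0 : (0 : ℝ) < (hypercubeGraph n).edgeSet.ncard :=
      mod_cast ncard_edgeSet_hypercubeGraph_pos hn
    have p1 : (0 : ℝ) < (hypercubeGraph (n + 1)).edgeSet.ncard :=
      mod_cast ncard_edgeSet_hypercubeGraph_pos (Nat.succ_ne_zero n)
    unfold edgeTransversalRatio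
    rw [div_le_div_iff₀ p0 p1]
    norm_cast
    generalize (hypercubeGraph (n + 1)).edgeSet.ncard = e1 at *
    generalize (hypercubeGraph n).edgeSet.ncard = e0 at *
    refine Nat.le_of_mul_le_mul_left ?_ (Nat.pos_of_ne_zero hn)
    calc n * (minEdgeTransversal n d * e1) = 2 * (n + 1) * minEdgeTransversal n d * e0 := by
          rw [mul_left_comm, h1]; ring
      _ ≤ n * minEdgeTransversal (n + 1) d * e0 := Nat.mul_le_mul_right _ h2
      _ = n * (minEdgeTransversal (n + 1) d * e0) := mul_assoc _ _ _

/-! ### The exponential bound. -/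

theorem edgeTransversalRatio_le_of_exists {d n s : ℕ}
    (h : ∃ G : (hypercubeGraph n).Subgraph, MeetsEveryCube d G ∧
      2 ^ s * G.edgeSet.ncard ≤ (hypercubeGraph n).edgeSet.ncard) :
    edgeTransversalRatio d n ≤ (1 / 2) ^ s := by
  obtain ⟨G, hG, hle⟩ := h
  have h1 : 2 ^ s * minEdgeTransversal n d ≤ (hypercubeGraph n).edgeSet.ncard :=
    (Nat.mul_le_mul_left _ (minEdgeTransversal_le hG)).trans hle
  have h2 : (2 : ℝ) ^ s * minEdgeTransversal n d ≤ (hypercubeGraph n).edgeSet.ncard := by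
    exact_mod_cast h1
  refine div_le_of_le_mul₀ (by positivity) (by positivity) ?_
  rw [one_div, inv_pow, ← div_eq_inv_mul, le_div_iff₀ (by positivity)]
  linarith

/-- For `d ≥ 9` the largest `s` with `3 * (s + 1) < d` is taken; smaller `d` use the parity
transversal with `s = 1`. The factor 9 is forced by `d = 9`, where both choices give `s = 1`. -/
theorem exists_exponent_edgeTransversalRatio_le {d : ℕ} (hd : 2 ≤ d) :
    ∃ s : ℕ, d ≤ 9 * s ∧ ∀ n, edgeTransversalRatio d n ≤ (1 / 2) ^ s := by
  rcases le_total d 9 with h | h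
  · exact ⟨1, by omega, fun n => edgeTransversalRatio_le_of_exists
      (by simpa using exists_parity_transversal n hd)⟩
  · exact ⟨(d - 1) / 3 - 1, by omega, fun n => edgeTransversalRatio_le_of_exists
      (exists_hyperplane_transversal n (by omega))⟩

theorem mainTheorem6 :
    ∃ c : ℝ, 0 < c ∧ c < 1 ∧ ∀ d : ℕ, 2 ≤ d →
      Tendsto (edgeTransversalRatio d) atTop (𝓝 (complEdgeTuranDensity d)) ∧
        complEdgeTuranDensity d ≤ c ^ d := by
  -- The constant is the ninth root of 1/2, so that (1/2)^s = c^(9s) ≤ c^d whenever `d ≤ 9 * s`.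
  have hc9 : (((1 / 2 : ℝ) ^ (1 / 9 : ℝ)) ^ 9) = 1 / 2 := by
    rw [← Real.rpow_natCast, ← Real.rpow_mul (by norm_num)]
    norm_num
  have hc0 : (0 : ℝ) < (1 / 2 : ℝ) ^ (1 / 9 : ℝ) := by positivity
  have hc1 : (1 / 2 : ℝ) ^ (1 / 9 : ℝ) < 1 :=
    Real.rpow_lt_one (by norm_num) (by norm_num) (by norm_num)
  generalize (1 / 2 : ℝ) ^ (1 / 9 : ℝ) = c at hc9 hc0 hc1
  refine ⟨c, hc0, hc1, fun d hd => ?_⟩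
  obtain ⟨s, hs, hle⟩ := exists_exponent_edgeTransversalRatio_le hd
  have hlim := tendsto_atTop_ciSup (edgeTransversalRatio_monotone hd)
    ⟨_, Set.forall_mem_range.2 hle⟩
  have heq : complEdgeTuranDensity d = ⨆ n, edgeTransversalRatio d n := hlim.limUnder_eq
  rw [heq]
  refine ⟨hlim, (ciSup_le hle).trans ?_⟩
  rw [← hc9, ← pow_mul]
  exact pow_le_pow_of_le_one hc0.le hc1.le hs
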